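/- For integers $a,b\ge 0$ let $$\zeta(\{1\}^a,b+2)=\sum_{1\le k_1<k_2<\cdots<k_{a+1}}\frac{1}{k_1k_2\cdots k_a\,k_{a+1}^{b+2}},\qquad \zeta^\star(\{1\}^a,b+2)=\sum_{1\le k_1\le k_2\le\cdots\le k_{a+1}}\frac{1}{k_1k_2\cdots k_a\,k_{a+1}^{b+2}}$$ be the multiple zeta and zeta-star values of height one, and for integers $n\ge 0$ put $$Z_-(n)=\sum_{\substack{a+b=n\\ a,b\ge 0}}(-1)^b\,\zeta(\{1\}^a,b+2),\qquad Z^\star_+(n)=\sum_{\substack{a+b=n\\ a,b\ge 0}}\zeta^\star(\{1\}^a,b+2).$$ Then for every integer $p\ge 0$, $$\sum_{m=0}^{p}Z_-(2m)\,Z^\star_+(2p-2m)=(2p+2)\left(2p+1+2^{-(2p+2)}\right)\zeta(2p+4),$$ where $\zeta$ is the Riemann zeta function. -/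

import Mathlib

/-- The multiple zeta value
`ζ(α₁, …, α_r) = ∑_{1 ≤ k₁ < ⋯ < k_r} k₁^{-α₁} ⋯ k_r^{-α_r}`.
The series has nonnegative terms; it converges when all `αᵢ ≥ 1` and `α_r ≥ 2`. -/
noncomputable def multipleZeta {r : ℕ} (α : Fin r → ℕ) : ℝ :=
  ∑' k : {k : Fin r → ℕ // (∀ i, 1 ≤ k i) ∧ StrictMono k},
    ∏ i : Fin r, ((k.1 i : ℝ) ^ α i)⁻¹

/-- The multiple zeta-star value
`ζ⋆(α₁, …, α_r) = ∑_{1 ≤ k₁ ≤ ⋯ ≤ k_r} k₁^{-α₁} ⋯ k_r^{-α_r}`.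
The series has nonnegative terms; it converges when all `αᵢ ≥ 1` and `α_r ≥ 2`. -/
noncomputable def multipleZetaStar {r : ℕ} (α : Fin r → ℕ) : ℝ :=
  ∑' k : {k : Fin r → ℕ // (∀ i, 1 ≤ k i) ∧ Monotone k},
    ∏ i : Fin r, ((k.1 i : ℝ) ^ α i)⁻¹

/-- The height-one index `({1}^a, b + 2)`: `a` ones followed by the entry `b + 2`. -/
def heightOneIndex (a b : ℕ) : Fin (a + 1) → ℕ :=
  Fin.snoc (α := fun _ => ℕ) (fun _ : Fin a => 1) (b + 2)

/-- `Z₋(n) = ∑_{a + b = n} (-1)^b ζ({1}^a, b + 2)`. -/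
noncomputable def ZMinus (n : ℕ) : ℝ :=
  ∑ ab ∈ Finset.HasAntidiagonal.antidiagonal n, (-1 : ℝ) ^ ab.2 * multipleZeta (heightOneIndex ab.1 ab.2)

/-- `Z⋆₊(n) = ∑_{a + b = n} ζ⋆({1}^a, b + 2)`. -/
noncomputable def ZStarPlus (n : ℕ) : ℝ :=
  ∑ ab ∈ Finset.HasAntidiagonal.antidiagonal n, multipleZetaStar (heightOneIndex ab.1 ab.2)

/-!
Both families of sums are evaluated through generating functions, in terms of the alternating zeta
values `η(s) = (1 - 2^(1-s)) ζ(s)`; the convolution then reduces to a formal power series identity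
for `π x / sin (π x)`.

*Generating functions.* Isolating the largest index `k`, the sum over the remaining `a` indices is
an elementary or complete homogeneous symmetric function of `1, 1/2, …`, whose generating function
in `a` is `∏ (1 + x / j)` or `∏ (1 - x / j)⁻¹`. Summing geometric series in `b` as well
(`hasSum_antidiagonal_heightOne`) gives, for small real `x`,
`∑ Z₋(n) xⁿ = ∑ₖ ∏_{j < k} (1 + x / j) / (k (k + x))` and
`∑ Z⋆₊(n) xⁿ = ∑ₖ ∏_{j ≤ k} (1 - x / j)⁻¹ / (k (k - x))`.

*Evaluation of `Z⋆₊`.* As a function `I(y)` of `y = -x`, the second series satisfies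
`I(y) + I(y + 1) = 2 / (y + 1)²` because the sum of the two series telescopes
(`starGen_add_starGen`). Hence `I(y) = 2 ∑ (-1)^r / (y + r + 1)²`, and `Z⋆₊(n) = 2 (n + 1) η(n + 2)`
(`ZStarPlus_eq`).

*Evaluation of `Z₋`.* The first series is `x⁻² (₂F₁(x, x; 1 + x; 1) - 1)`. A telescoping contiguity
relation (`tsum_gaussTerm_step`) turns the hypergeometric value into Euler's product for the sine,
so that `1 + ∑ Z₋(n) x^(n+2) = π x / sin (π x)`. In terms of the Bernoulli series
`B = X / (exp X - 1)` this is `2 B(X / 2) - B` at `2 π i X` (`minusSeries_eq`), whence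
`Z₋(2m) = 2 η(2m + 2)` and `Z₋(2m + 1) = 0`.

*Convolution.* Thus `Z⋆₊(2m) = (2m + 1) Z₋(2m)`, and by the symmetry `m ↔ p - m` the sum in question
is `(p + 1) ∑ Z₋(2m) Z₋(2p - 2m)`. This last sum is a coefficient of the square of
`π x / sin (π x)`, and `(2 B(X / 2) - B)² = B - X B'` (`sq_two_mul_rescale_bernoulli_sub`) expresses
it by a single Bernoulli number, that is, by `ζ(2p + 4)`.
-/

/-! ### Height-one values as single series -/

/-- The sum of `∏ 1 / (lᵢ + 1)` over all chains `l₀, …, l_{a-1}` with `lᵢ ∈ D lᵢ₊₁` for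
`i < a - 1` and `l_{a-1} ∈ D k`. For `D = Finset.range` the chains are the strictly increasing
sequences below `k`, for `D j = Finset.range (j + 1)` the weakly increasing sequences up to `k`.
Entries are shifted by one, so that they range over all of `ℕ`. -/
noncomputable def chainSum (D : ℕ → Finset ℕ) : ℕ → ℕ → ℝ
  | 0, _ => 1
  | a + 1, k => ∑ j ∈ D k, chainSum D a j / (j + 1)

theorem chainSum_nonneg (D : ℕ → Finset ℕ) (a k : ℕ) : 0 ≤ chainSum D a k := by
  induction a generalizing k with
  | zero => simp [chainSum]
  | succ a ih => exact Finset.sum_nonneg fun j _ => div_nonneg (ih j) (by positivity)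

theorem forall_lt_mem_snoc_iff {D : ℕ → Finset ℕ} {a : ℕ} (l : Fin a → ℕ) (k : ℕ) :
    (∀ i j : Fin (a + 1), i < j →
      (Fin.snoc l k : Fin (a + 1) → ℕ) i ∈ D ((Fin.snoc l k : Fin (a + 1) → ℕ) j)) ↔
      (∀ i j, i < j → l i ∈ D (l j)) ∧ ∀ i, l i ∈ D k := by
  simp [Fin.forall_fin_succ', Fin.castSucc_lt_last, forall_and, Fin.le_last]

theorem tsum_chain_below {D : ℕ → Finset ℕ}
    (htrans : ∀ i j k, i ∈ D j → j ∈ D k → i ∈ D k) (a k : ℕ) :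
    ∑' l : Fin a → ℕ, {l : Fin a → ℕ | (∀ i j, i < j → l i ∈ D (l j)) ∧ ∀ i, l i ∈ D k}.indicator
      (fun l => ∏ i, ENNReal.ofReal (1 / ((l i : ℝ) + 1))) l =
      ENNReal.ofReal (chainSum D a k) := by
  classical
  induction a generalizing k with
  | zero =>
    rw [tsum_eq_single (fun i : Fin 0 => i.elim0) (fun l hl => (hl (Subsingleton.elim _ _)).elim)]
    simp [chainSum]
  | succ a ih =>
    rw [← (Fin.snocEquiv fun _ : Fin (a + 1) => ℕ).tsum_eq,
      ENNReal.summable.tsum_prod' fun _ => ENNReal.summable]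
    have key : ∀ j : ℕ, (∑' l : Fin a → ℕ,
        {l : Fin (a + 1) → ℕ | (∀ i j, i < j → l i ∈ D (l j)) ∧ ∀ i, l i ∈ D k}.indicator
          (fun l => ∏ i, ENNReal.ofReal (1 / ((l i : ℝ) + 1)))
          ((Fin.snocEquiv fun _ : Fin (a + 1) => ℕ) (j, l))) =
        if j ∈ D k then ENNReal.ofReal (chainSum D a j / (j + 1)) else 0 := by
      intro j
      split_ifs with hj
      · rw [div_eq_mul_one_div, ENNReal.ofReal_mul (chainSum_nonneg D a j), ← ih j,
          ← ENNReal.tsum_mul_right]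
        refine tsum_congr fun l => ?_
        have hiff : ((Fin.snocEquiv fun _ : Fin (a + 1) => ℕ) (j, l) ∈ {l : Fin (a + 1) → ℕ |
            (∀ i j, i < j → l i ∈ D (l j)) ∧ ∀ i, l i ∈ D k}) ↔
            l ∈ {l : Fin a → ℕ | (∀ i j, i < j → l i ∈ D (l j)) ∧ ∀ i, l i ∈ D j} := by
          simp only [Fin.snocEquiv_apply, Set.mem_ofPred_eq, forall_lt_mem_snoc_iff]
          refine ⟨fun h => h.1, fun h => ⟨h, ?_⟩⟩
          simp only [Fin.forall_fin_succ', Fin.snoc_castSucc, Fin.snoc_last]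
          exact ⟨fun i => htrans _ _ _ (h.2 i) hj, hj⟩
        by_cases h : l ∈ {l : Fin a → ℕ | (∀ i j, i < j → l i ∈ D (l j)) ∧ ∀ i, l i ∈ D j}
        · rw [Set.indicator_of_mem (hiff.2 h), Set.indicator_of_mem h]
          simp [Fin.prod_univ_castSucc]
        · rw [Set.indicator_of_notMem (fun h' => h (hiff.1 h')), Set.indicator_of_notMem h,
            zero_mul]
      · refine ENNReal.tsum_eq_zero.2 fun l => Set.indicator_of_notMem (fun h => hj ?_) _
        simpa using h.2 (Fin.last a)
    simp only [key]
    rw [tsum_eq_sum (s := D k) (fun j hj => if_neg hj), chainSum,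
      ENNReal.ofReal_sum_of_nonneg
        (fun j _ => div_nonneg (chainSum_nonneg D a j) (by positivity))]
    exact Finset.sum_congr rfl fun j hj => if_pos hj

/-- A height-one multiple zeta (star) value is a single series over the largest index: the sum over
the `a` smaller indices is `chainSum D a k`. -/
theorem tsum_heightOne_eq {D : ℕ → Finset ℕ}
    (htrans : ∀ i j k, i ∈ D j → j ∈ D k → i ∈ D k) (a b : ℕ) (P : (Fin (a + 1) → ℕ) → Prop)
    (hP : ∀ l : Fin (a + 1) → ℕ, P (fun i => l i + 1) ↔ ∀ i j, i < j → l i ∈ D (l j)) :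
    ∑' k : {k : Fin (a + 1) → ℕ // (∀ i, 1 ≤ k i) ∧ P k},
      ∏ i, ((k.1 i : ℝ) ^ heightOneIndex a b i)⁻¹ =
      ∑' k : ℕ, chainSum D a k / ((k : ℝ) + 1) ^ (b + 2) := by
  classical
  let e : {l : Fin (a + 1) → ℕ | ∀ i j, i < j → l i ∈ D (l j)} ≃
      {k : Fin (a + 1) → ℕ // (∀ i, 1 ≤ k i) ∧ P k} :=
    { toFun := fun l => ⟨fun i => l.1 i + 1, fun i => by lia, (hP l.1).2 l.2⟩
      invFun := fun k => ⟨fun i => k.1 i - 1, (hP _).1 (by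
        have : (fun i => k.1 i - 1 + 1) = k.1 := funext fun i => Nat.sub_add_cancel (k.2.1 i)
        rw [this]; exact k.2.2)⟩
      left_inv := fun l => by ext; simp
      right_inv := fun k => by
        ext i
        exact Nat.sub_add_cancel (k.2.1 i) }
  rw [← e.tsum_eq]
  -- Rearrangements are done in `ℝ≥0∞`, where they need no summability.
  have hL : ∀ l : {l : Fin (a + 1) → ℕ | ∀ i j, i < j → l i ∈ D (l j)},
      ∏ i, (((e l).1 i : ℝ) ^ heightOneIndex a b i)⁻¹ =
      (ENNReal.ofReal (∏ i, (((l.1 i : ℝ) + 1) ^ heightOneIndex a b i)⁻¹)).toReal := by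
    intro l
    rw [ENNReal.toReal_ofReal (by positivity)]
    simp [e]
  have hR : ∀ k : ℕ, chainSum D a k / ((k : ℝ) + 1) ^ (b + 2) =
      (ENNReal.ofReal (chainSum D a k / ((k : ℝ) + 1) ^ (b + 2))).toReal := fun k =>
    (ENNReal.toReal_ofReal (div_nonneg (chainSum_nonneg D a k) (by positivity))).symm
  rw [tsum_congr hL, tsum_congr hR,
    ← ENNReal.tsum_toReal_eq (fun _ => ENNReal.ofReal_ne_top),
    ← ENNReal.tsum_toReal_eq (fun _ => ENNReal.ofReal_ne_top)]
  congr 1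
  rw [tsum_subtype {l : Fin (a + 1) → ℕ | ∀ i j, i < j → l i ∈ D (l j)}
    (fun l => ENNReal.ofReal (∏ i, (((l i : ℝ) + 1) ^ heightOneIndex a b i)⁻¹)),
    ← (Fin.snocEquiv fun _ : Fin (a + 1) => ℕ).tsum_eq,
      ENNReal.summable.tsum_prod' fun _ => ENNReal.summable]
  refine tsum_congr fun k => ?_
  rw [div_eq_mul_inv, ENNReal.ofReal_mul (chainSum_nonneg D a k), ← tsum_chain_below htrans a k,
    ← ENNReal.tsum_mul_right]
  refine tsum_congr fun l => ?_
  simp only [Fin.snocEquiv_apply, Set.indicator_apply, Set.mem_ofPred_eq, forall_lt_mem_snoc_iff]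
  split_ifs
  · rw [Fin.prod_univ_castSucc, ENNReal.ofReal_mul (by positivity),
      ENNReal.ofReal_prod_of_nonneg (fun _ _ => by positivity)]
    simp [heightOneIndex]
  · simp

theorem multipleZeta_heightOneIndex (a b : ℕ) :
    multipleZeta (heightOneIndex a b) =
      ∑' k : ℕ, chainSum Finset.range a k / ((k : ℝ) + 1) ^ (b + 2) :=
  tsum_heightOne_eq (by simp only [Finset.mem_range]; lia) a b StrictMono fun l => by
    simp [StrictMono]

theorem multipleZetaStar_heightOneIndex (a b : ℕ) :
    multipleZetaStar (heightOneIndex a b) =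
      ∑' k : ℕ, chainSum (fun j => Finset.range (j + 1)) a k / ((k : ℝ) + 1) ^ (b + 2) :=
  tsum_heightOne_eq (by simp only [Finset.mem_range]; lia) a b Monotone fun l => by
    simp [monotone_iff_forall_lt, Order.lt_add_one_iff]

/-! ### Generating functions -/

theorem chainSum_range_succ (a k : ℕ) :
    chainSum Finset.range (a + 1) (k + 1) =
      chainSum Finset.range (a + 1) k + chainSum Finset.range a k / (k + 1) := by
  simp only [chainSum, Finset.sum_range_succ]

theorem hasSum_chainSum_range (x : ℝ) (k : ℕ) :
    HasSum (fun a => chainSum Finset.range a k * x ^ a)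
      (∏ j ∈ Finset.range k, (1 + x / ((j : ℝ) + 1))) := by
  induction k with
  | zero =>
    convert! hasSum_ite_eq 0 (1 : ℝ) using 2 with a
    cases a <;> simp [chainSum]
  | succ k ih =>
    rw [Finset.prod_range_succ, ← hasSum_nat_add_iff' 1]
    convert! ((hasSum_nat_add_iff' 1).2 ih).add (ih.mul_right (x / ((k : ℝ) + 1))) using 1
    · funext a
      rw [chainSum_range_succ]
      ring
    · simp [chainSum]
      ring

theorem chainSum_range_add_one_succ (a k : ℕ) :
    chainSum (fun j => Finset.range (j + 1)) a (k + 1) =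
      ∑ ij ∈ Finset.HasAntidiagonal.antidiagonal a,
        chainSum (fun j => Finset.range (j + 1)) ij.1 k * (1 / ((k : ℝ) + 2)) ^ ij.2 := by
  induction a with
  | zero => simp [chainSum]
  | succ a ih =>
    have h : chainSum (fun j => Finset.range (j + 1)) (a + 1) (k + 1) =
        chainSum (fun j => Finset.range (j + 1)) (a + 1) k +
          chainSum (fun j => Finset.range (j + 1)) a (k + 1) / (k + 2) := by
      rw [chainSum, chainSum, Finset.sum_range_succ]
      push_cast
      ring
    rw [h, ih, Finset.Nat.antidiagonal_succ', Finset.sum_cons, Finset.sum_map, Finset.sum_div]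
    congr 1
    · simp
    · refine Finset.sum_congr rfl fun ij _ => ?_
      simp only [Function.Embedding.prodMap, Function.Embedding.coeFn_mk, Prod.map,
        Function.Embedding.refl_apply, Nat.succ_eq_add_one]
      rw [pow_succ]
      ring

theorem hasSum_chainSum_range_add_one {x : ℝ} (hx : |x| < 1) (k : ℕ) :
    HasSum (fun a => chainSum (fun j => Finset.range (j + 1)) a k * x ^ a)
      (∏ j ∈ Finset.range (k + 1), (1 - x / ((j : ℝ) + 1))⁻¹) := by
  -- The Cauchy product below needs absolute convergence, so it is carried along.
  suffices ∀ k, (∀ y : ℝ, |y| < 1 →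
      HasSum (fun a => chainSum (fun j => Finset.range (j + 1)) a k * y ^ a)
      (∏ j ∈ Finset.range (k + 1), (1 - y / ((j : ℝ) + 1))⁻¹)) from this k x hx
  intro k
  induction k with
  | zero =>
    intro y hy
    have h1 : ∀ a, chainSum (fun j => Finset.range (j + 1)) a 0 = 1 := by
      intro a
      induction a with
      | zero => rfl
      | succ a ih => simp [chainSum, ih]
    simpa [h1] using hasSum_geometric_of_abs_lt_one hy
  | succ k ih =>
    intro y hy
    have hy2 : |y / ((k : ℝ) + 2)| < 1 := by
      rw [abs_div, abs_of_pos (by positivity : (0 : ℝ) < k + 2), div_lt_one (by positivity)]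
      have : (0 : ℝ) ≤ k := k.cast_nonneg
      linarith
    have hs1 : Summable fun a =>
        ‖chainSum (fun j => Finset.range (j + 1)) a k * y ^ a‖ := by
      simpa [abs_mul, abs_of_nonneg (chainSum_nonneg _ _ _)] using
        (ih |y| (by rwa [abs_abs])).summable
    have hs2 : Summable fun a => ‖(y / ((k : ℝ) + 2)) ^ a‖ :=
      summable_norm_geometric_of_norm_lt_one hy2
    have h := (summable_norm_sum_mul_antidiagonal_of_summable_norm hs1 hs2).of_norm.hasSum
    rw [← tsum_mul_tsum_eq_tsum_sum_antidiagonal_of_summable_norm hs1 hs2, (ih y hy).tsum_eq,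
      tsum_geometric_of_abs_lt_one hy2] at h
    rw [Finset.prod_range_succ]
    convert! h using 1
    · funext a
      rw [chainSum_range_add_one_succ, Finset.sum_mul]
      refine Finset.sum_congr rfl fun ij hij => ?_
      rw [← Finset.HasAntidiagonal.mem_antidiagonal.1 hij, div_pow, pow_add, div_pow, one_pow]
      ring
    · push_cast
      ring_nf

/-- The growth bound `w k = O(√k)` gives convergence of the outer sum over the largest index; it
holds for the inner generating functions at parameters in `[0, 1/4]`. -/
theorem summable_div_of_sq_le {w : ℕ → ℝ} (hw0 : ∀ k, 0 ≤ w k) (hw : ∀ k, w k ^ 2 ≤ k + 2)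
    {t : ℝ} (ht : t ≤ 1 / 4) :
    Summable fun k : ℕ => w k / (((k : ℝ) + 1) * (k + 1 - t)) := by
  have hs : Summable fun k : ℕ => 4 * (1 / (((k + 1 : ℕ) : ℝ) ^ (3 / 2 : ℝ))) :=
    ((summable_nat_add_iff 1).2
      (Real.summable_one_div_nat_rpow.2 (by norm_num : (1 : ℝ) < 3 / 2))).mul_left 4
  have hk : ∀ k : ℕ, (0 : ℝ) < (k : ℝ) + 1 - t := fun k => by
    have : (0 : ℝ) ≤ k := k.cast_nonneg
    linarith
  refine Summable.of_nonneg_of_le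
    (fun k => div_nonneg (hw0 k) (mul_nonneg (by positivity) (hk k).le)) (fun k => ?_) hs
  have h0 : (0 : ℝ) ≤ k := k.cast_nonneg
  set s := √((k : ℝ) + 1) with hsdef
  have hs0 : 0 < s := Real.sqrt_pos.2 (by positivity)
  have hs2 : s ^ 2 = k + 1 := Real.sq_sqrt (by positivity)
  have hpow : (((k + 1 : ℕ) : ℝ) ^ (3 / 2 : ℝ)) = s ^ 3 := by
    rw [hsdef, Real.sqrt_eq_rpow, ← Real.rpow_natCast, ← Real.rpow_mul (by positivity)]
    push_cast
    norm_num
  have hws : w k ≤ 2 * s := abs_le_of_sq_le_sq' (by nlinarith [hw k]) (by positivity) |>.2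
  rw [hpow, mul_one_div, div_le_div_iff₀ (mul_pos (by positivity) (hk k)) (by positivity), ← hs2]
  have h1 : s ^ 2 / 2 ≤ s ^ 2 - t := by nlinarith
  calc w k * s ^ 3 ≤ 2 * s * s ^ 3 := by gcongr
    _ = 4 * (s ^ 2 * (s ^ 2 / 2)) := by ring
    _ ≤ 4 * (s ^ 2 * (s ^ 2 - t)) := by gcongr

theorem hasSum_sum_antidiagonal {f : ℕ × ℕ → ℝ} {s : ℝ} (hf : HasSum f s) :
    HasSum (fun n => ∑ ab ∈ Finset.HasAntidiagonal.antidiagonal n, f ab) s := by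
  have h := (Finset.HasAntidiagonal.sigmaAntidiagonalEquivProd.hasSum_iff.2 hf).sigma
    fun n => hasSum_fintype _
  convert! h using 2 with n
  exact (Finset.sum_coe_sort _ f).symm

/-- The generating function of the `ε`-weighted antidiagonal sums of height-one values, once the
generating function `W k` of the inner sums over the `a` smaller indices is known. -/
theorem hasSum_antidiagonal_heightOne {D : ℕ → Finset ℕ} {W : ℕ → ℝ → ℝ}
    (hW : ∀ k t, |t| < 1 → HasSum (fun a => chainSum D a k * t ^ a) (W k t))
    (hsq : ∀ k t, 0 ≤ t → t ≤ 1 / 4 → W k t ^ 2 ≤ k + 2)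
    {ε x : ℝ} (hε : |ε| = 1) (hx : |x| ≤ 1 / 4) :
    HasSum (fun n : ℕ => (∑ ab ∈ Finset.HasAntidiagonal.antidiagonal n,
        ε ^ ab.2 * ∑' k : ℕ, chainSum D ab.1 k / ((k : ℝ) + 1) ^ (ab.2 + 2)) * x ^ n)
      (∑' k : ℕ, W k x / (((k : ℝ) + 1) * (k + 1 - ε * x))) := by
  have hgeom : ∀ (k : ℕ) (t : ℝ), |t| ≤ 1 / 4 →
      HasSum (fun b : ℕ => t ^ b / ((k : ℝ) + 1) ^ (b + 2))
        (1 / (((k : ℝ) + 1) * (k + 1 - t))) := by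
    intro k t ht
    have h0 : (0 : ℝ) ≤ k := k.cast_nonneg
    have hlt : |t / ((k : ℝ) + 1)| < 1 := by
      rw [abs_div, abs_of_pos (by positivity : (0 : ℝ) < k + 1), div_lt_one (by positivity)]
      linarith
    have hne : (k : ℝ) + 1 - t ≠ 0 := by have := (abs_le.1 ht).2; linarith
    convert! (hasSum_geometric_of_abs_lt_one hlt).mul_left (1 / ((k : ℝ) + 1) ^ 2) using 1
    · funext b
      rw [div_pow, pow_add]
      field_simp
    · field_simp
  have hεx : |ε * x| ≤ 1 / 4 := by rwa [abs_mul, hε, one_mul]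
  have hx1 : |x| < 1 := by linarith
  have hx1' : |(|x|)| < 1 := by rwa [abs_abs]
  have hx4' : |(|x|)| ≤ 1 / 4 := by rwa [abs_abs]
  set F : ℕ × ℕ × ℕ → ℝ := fun p => (chainSum D p.2.1 p.1 * x ^ p.2.1) *
    ((ε * x) ^ p.2.2 / ((p.1 : ℝ) + 1) ^ (p.2.2 + 2)) with hF
  have hnorm : ∀ k a b, |F (k, a, b)| = (chainSum D a k * |x| ^ a) *
      (|x| ^ b / ((k : ℝ) + 1) ^ (b + 2)) := by
    intro k a b
    have h1 : |(k : ℝ) + 1| = k + 1 := abs_of_pos (by positivity)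
    simp [hF, abs_mul, abs_div, abs_pow, hε, h1, abs_of_nonneg (chainSum_nonneg D a k)]
  have hWn : ∀ k, 0 ≤ W k |x| := fun k => (hW k _ hx1').nonneg fun a =>
    mul_nonneg (chainSum_nonneg D a k) (by positivity)
  have hrow : ∀ k, HasSum (fun q : ℕ × ℕ => |F (k, q)|)
      (W k |x| * (1 / (((k : ℝ) + 1) * (k + 1 - |x|)))) := by
    intro k
    have hf0 : 0 ≤ fun a => chainSum D a k * |x| ^ a := fun a =>
      mul_nonneg (chainSum_nonneg D a k) (pow_nonneg (abs_nonneg x) a)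
    have hg0 : 0 ≤ fun b : ℕ => |x| ^ b / ((k : ℝ) + 1) ^ (b + 2) := fun b =>
      div_nonneg (pow_nonneg (abs_nonneg x) b) (by positivity)
    have h := (hW k _ hx1').mul (hgeom k _ hx4')
      ((hW k _ hx1').summable.mul_of_nonneg (hgeom k _ hx4').summable hf0 hg0)
    exact h.congr_fun fun q => hnorm k q.1 q.2
  have hsF : Summable F := by
    refine Summable.of_abs ((summable_prod_of_nonneg fun p => abs_nonneg (F p)).2
      ⟨fun k => (hrow k).summable, ?_⟩)
    simp only [(hrow _).tsum_eq, mul_one_div]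
    exact summable_div_of_sq_le hWn (fun k => hsq k _ (abs_nonneg x) hx) hx
  have hrow' : ∀ k, HasSum (fun q : ℕ × ℕ => F (k, q))
      (W k x / (((k : ℝ) + 1) * (k + 1 - ε * x))) := by
    intro k
    rw [div_eq_mul_one_div]
    have hs : Summable fun q : ℕ × ℕ => (chainSum D q.1 k * x ^ q.1) *
        ((ε * x) ^ q.2 / ((k : ℝ) + 1) ^ (q.2 + 2)) := (hrow k).summable.of_abs
    have h := (hW k x hx1).mul (hgeom k _ hεx) hs
    exact h
  have htot : ∑' k : ℕ, W k x / (((k : ℝ) + 1) * (k + 1 - ε * x)) = ∑' p, F p := by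
    rw [hsF.tsum_prod]
    exact tsum_congr fun k => (hrow' k).tsum_eq.symm
  have hcol : HasSum (fun q : ℕ × ℕ => ∑' k, F (k, q)) (∑' p, F p) := by
    have hswap : Summable fun p : (ℕ × ℕ) × ℕ => F p.swap := hsF.prod_symm
    have h := hswap.hasSum.prod_fiberwise fun q => (hswap.prod_factor q).hasSum
    have e := (Equiv.prodComm (ℕ × ℕ) ℕ).tsum_eq F
    simp only [Equiv.prodComm_apply] at e
    rw [e] at h
    exact h
  rw [htot]
  refine (hasSum_sum_antidiagonal hcol).congr_fun fun n => ?_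
  rw [Finset.sum_mul]
  refine Finset.sum_congr rfl fun ab hab => ?_
  rw [← Finset.HasAntidiagonal.mem_antidiagonal.1 hab, mul_right_comm, ← tsum_mul_left]
  refine tsum_congr fun k => ?_
  simp only [hF]
  rw [pow_add, mul_pow]
  ring

/-! ### Uniqueness of coefficients -/

theorem eq_zero_of_hasSum_pow_zero {𝕜 : Type*} [RCLike 𝕜] {d : ℕ → 𝕜} {δ : ℝ} (hδ : 0 < δ)
    (h : ∀ x : ℝ, 0 < x → x < δ → HasSum (fun n => d n * (x : 𝕜) ^ n) 0) : d = 0 := by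
  set p := FormalMultilinearSeries.ofScalars 𝕜 d with hp
  have hrad : 0 < p.radius := by
    have ht := (h (δ / 2) (by linarith) (by linarith)).summable.tendsto_atTop_zero.norm
    have hle := p.le_radius_of_tendsto (r := (δ / 2).toNNReal) (l := ‖(0 : 𝕜)‖) <| by
      refine ht.congr fun n => ?_
      rw [hp, FormalMultilinearSeries.ofScalars_norm, norm_mul, norm_pow, RCLike.norm_ofReal,
        abs_of_pos (by linarith), Real.coe_toNNReal _ (by linarith)]
    exact lt_of_lt_of_le (by simpa using hδ) hle
  have hball := p.hasFPowerSeriesOnBall hrad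
  have hfreq : ∃ᶠ z in nhdsWithin (0 : 𝕜) {0}ᶜ, p.sum z = 0 := by
    have hto : Filter.Tendsto (fun x : ℝ => (x : 𝕜)) (nhdsWithin 0 (Set.Ioi 0))
        (nhdsWithin 0 {0}ᶜ) := by
      refine tendsto_nhdsWithin_iff.2 ⟨?_, ?_⟩
      · exact ((RCLike.continuous_ofReal (K := 𝕜)).tendsto' 0 0 (by simp)).mono_left
          nhdsWithin_le_nhds
      · filter_upwards [self_mem_nhdsWithin] with x hx
        simpa using (ne_of_gt hx : x ≠ 0)
    refine hto.frequently (Filter.Eventually.frequently ?_)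
    filter_upwards [Ioo_mem_nhdsGT hδ] with x hx
    have := (h x hx.1 hx.2).tsum_eq
    rw [hp, ← FormalMultilinearSeries.ofScalarsSum, FormalMultilinearSeries.ofScalars_sum_eq]
    simpa [smul_eq_mul] using this
  have hzero := hball.analyticAt.frequently_zero_iff_eventually_zero.1 hfreq
  exact (FormalMultilinearSeries.ofScalars_series_eq_zero 𝕜).1
    (hball.hasFPowerSeriesAt.eq_zero_of_eventually hzero)

/-- Uniqueness of power series coefficients, from equality on a one-sided real neighbourhood. -/
theorem eq_of_hasSum_pow {𝕜 : Type*} [RCLike 𝕜] {c d : ℕ → 𝕜} {δ : ℝ} (hδ : 0 < δ)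
    (f : ℝ → 𝕜) (hc : ∀ x : ℝ, 0 < x → x < δ → HasSum (fun n => c n * (x : 𝕜) ^ n) (f x))
    (hd : ∀ x : ℝ, 0 < x → x < δ → HasSum (fun n => d n * (x : 𝕜) ^ n) (f x)) : c = d := by
  refine sub_eq_zero.1 (eq_zero_of_hasSum_pow_zero hδ fun x h0 h1 => ?_)
  simpa [sub_mul] using (hc x h0 h1).sub (hd x h0 h1)

/-! ### Evaluation of the star sums -/

/-- The alternating zeta value `∑ r ≥ 1, (-1)^(r-1) / r^s`. -/
noncomputable def etaValue (s : ℕ) : ℝ := ∑' r : ℕ, (-1) ^ r / ((r : ℝ) + 1) ^ s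

/-- The product `∏_{j ≤ k + 1} j / (j + y)`. -/
noncomputable def starProd (y : ℝ) (k : ℕ) : ℝ :=
  ∏ j ∈ Finset.range (k + 1), (1 + y / ((j : ℝ) + 1))⁻¹

theorem starProd_pos {y : ℝ} (hy : 0 ≤ y) (k : ℕ) : 0 < starProd y k :=
  Finset.prod_pos fun j _ => by positivity

theorem starProd_le_one {y : ℝ} (hy : 0 ≤ y) (k : ℕ) : starProd y k ≤ 1 :=
  Finset.prod_le_one (fun j _ => by positivity) fun j _ =>
    inv_le_one_of_one_le₀ (le_add_of_nonneg_right (by positivity))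

theorem starProd_succ {y : ℝ} (hy : 0 ≤ y) (k : ℕ) :
    starProd y (k + 1) = starProd y k * ((k + 2) / (k + 2 + y)) := by
  rw [starProd, Finset.prod_range_succ, ← starProd]
  push_cast
  field_simp
  ring

theorem starProd_add_one {y : ℝ} (hy : 0 ≤ y) (k : ℕ) :
    starProd (y + 1) k = starProd y k * ((y + 1) / (y + k + 2)) := by
  induction k with
  | zero =>
    simp only [starProd, zero_add, Finset.prod_range_one]
    push_cast
    field_simp
    ring
  | succ k ih =>
    rw [starProd_succ hy, starProd_succ (by linarith), ih]
    push_cast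
    field_simp
    ring

/-- The value at `x = -y` of the generating function of the numbers `Z⋆₊(n)`. -/
noncomputable def starGen (y : ℝ) : ℝ :=
  ∑' k : ℕ, starProd y k / (((k : ℝ) + 1) * (k + 1 + y))

theorem summable_starGen {y : ℝ} (hy : 0 ≤ y) :
    Summable fun k : ℕ => starProd y k / (((k : ℝ) + 1) * (k + 1 + y)) := by
  have hs : Summable fun k : ℕ => 1 / (((k + 1 : ℕ) : ℝ) ^ 2) :=
    (summable_nat_add_iff 1).2 (Real.summable_one_div_nat_pow.2 one_lt_two)
  refine Summable.of_nonneg_of_le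
    (fun k => div_nonneg (starProd_pos hy k).le (by positivity)) (fun k => ?_) hs
  push_cast
  rw [sq]
  exact div_le_div₀ zero_le_one (starProd_le_one hy k) (by positivity)
    (mul_le_mul_of_nonneg_left (by linarith) (by positivity))

theorem starGen_nonneg {y : ℝ} (hy : 0 ≤ y) : 0 ≤ starGen y :=
  tsum_nonneg fun k => div_nonneg (starProd_pos hy k).le (by positivity)

/-- The shift relation behind the evaluation of `Z⋆₊`: the sum of the two series telescopes. -/
theorem starGen_add_starGen {y : ℝ} (hy : 0 ≤ y) :
    starGen y + starGen (y + 1) = 2 / (y + 1) ^ 2 := by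
  have hy1 : 0 ≤ y + 1 := by linarith
  rw [starGen, starGen, ← (summable_starGen hy).tsum_add (summable_starGen hy1)]
  -- The antidifference of the summand, found by Zeilberger's algorithm.
  set c : ℕ → ℝ := fun k => starProd y k / (k + 1) * (1 / (k + 1 + y) + 1 / (y + 1)) with hc
  have hterm : ∀ k : ℕ, starProd y k / (((k : ℝ) + 1) * (k + 1 + y)) +
      starProd (y + 1) k / (((k : ℝ) + 1) * (k + 1 + (y + 1))) = c k - c (k + 1) := by
    intro k
    simp only [hc]
    rw [starProd_add_one hy, starProd_succ hy]
    push_cast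
    field_simp
    ring
  have hlim : Filter.Tendsto c Filter.atTop (nhds 0) := by
    have h0 : Filter.Tendsto (fun k : ℕ => 2 * (1 / ((k : ℝ) + 1))) Filter.atTop (nhds 0) := by
      simpa using tendsto_one_div_add_atTop_nhds_zero_nat.const_mul (2 : ℝ)
    refine squeeze_zero (fun k => ?_) (fun k => ?_) h0
    · exact mul_nonneg (div_nonneg (starProd_pos hy k).le (by positivity)) (by positivity)
    · have h1 : 1 / ((k : ℝ) + 1 + y) ≤ 1 := by
        rw [div_le_one (by positivity)]
        have : (0 : ℝ) ≤ k := k.cast_nonneg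
        linarith
      have h2 : 1 / (y + 1) ≤ 1 := by
        rw [div_le_one (by positivity)]
        linarith
      have h3 : starProd y k / ((k : ℝ) + 1) ≤ 1 / ((k : ℝ) + 1) := by
        have := starProd_le_one hy k
        gcongr
      calc c k ≤ 1 / ((k : ℝ) + 1) * (1 + 1) :=
            mul_le_mul h3 (add_le_add h1 h2) (by positivity) (by positivity)
        _ = 2 * (1 / ((k : ℝ) + 1)) := by ring
  have hc0 : c 0 = 2 / (y + 1) ^ 2 := by
    simp only [hc, starProd, zero_add, Finset.prod_range_one]
    push_cast
    field_simp
    ring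
  have hsum := ((summable_starGen hy).add (summable_starGen hy1)).hasSum.tendsto_sum_nat
  refine tendsto_nhds_unique hsum ?_
  simp only [hterm, Finset.sum_range_sub']
  simpa [hc0] using hlim.const_sub (c 0)

theorem summable_alternating_sq {y : ℝ} (hy : 0 ≤ y) :
    Summable fun r : ℕ => (-1) ^ r * (2 / (y + r + 1) ^ 2) := by
  have hs : Summable fun k : ℕ => 2 * (1 / (((k + 1 : ℕ) : ℝ) ^ 2)) :=
    ((summable_nat_add_iff 1).2 (Real.summable_one_div_nat_pow.2 one_lt_two)).mul_left 2
  refine Summable.of_norm_bounded hs fun k => ?_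
  rw [norm_mul, norm_pow, norm_neg, norm_one, one_pow, one_mul, Real.norm_of_nonneg (by positivity),
    mul_one_div]
  push_cast
  gcongr
  linarith

/-- Iterating the shift relation; the remainder vanishes because
`0 ≤ starGen y ≤ 2 / (y + 1) ^ 2`. -/
theorem starGen_eq_tsum {y : ℝ} (hy : 0 ≤ y) :
    starGen y = ∑' r : ℕ, (-1) ^ r * (2 / (y + r + 1) ^ 2) := by
  have hpart : ∀ N : ℕ, ∑ r ∈ Finset.range N, (-1) ^ r * (2 / (y + r + 1) ^ 2) =
      starGen y - (-1) ^ N * starGen (y + N) := by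
    intro N
    induction N with
    | zero => simp
    | succ N ih =>
      rw [Finset.sum_range_succ, ih, ← starGen_add_starGen (by positivity : 0 ≤ y + N)]
      push_cast
      rw [← add_assoc y]
      ring
  have hlim : Filter.Tendsto (fun N : ℕ => (-1 : ℝ) ^ N * starGen (y + N)) Filter.atTop
      (nhds 0) := by
    have h0 : Filter.Tendsto (fun k : ℕ => 2 * (1 / ((k : ℝ) + 1))) Filter.atTop (nhds 0) := by
      simpa using tendsto_one_div_add_atTop_nhds_zero_nat.const_mul (2 : ℝ)
    refine squeeze_zero_norm (fun N => ?_) h0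
    have hN : 0 ≤ y + N := by positivity
    rw [norm_mul, norm_pow, norm_neg, norm_one, one_pow, one_mul,
      Real.norm_of_nonneg (starGen_nonneg hN), mul_one_div]
    calc starGen (y + N) ≤ 2 / (y + N + 1) ^ 2 := by
          rw [← starGen_add_starGen hN]
          have := starGen_nonneg (by linarith : 0 ≤ y + N + 1)
          linarith
      _ ≤ 2 / ((N : ℝ) + 1) := by
          gcongr
          have : (0 : ℝ) ≤ N := N.cast_nonneg
          nlinarith
  refine (tendsto_nhds_unique (summable_alternating_sq hy).hasSum.tendsto_sum_nat ?_).symm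
  simp only [hpart]
  simpa using hlim.const_sub (starGen y)

theorem hasSum_starGen {y : ℝ} (hy : 0 ≤ y) (hy1 : y < 1) :
    HasSum (fun n : ℕ => 2 * (n + 1) * etaValue (n + 2) * (-y) ^ n) (starGen y) := by
  have hgeom : ∀ t : ℝ, |t| < 1 →
      HasSum (fun n : ℕ => ((n : ℝ) + 1) * t ^ n) (1 / (1 - t) ^ 2) := by
    intro t ht
    simpa using hasSum_choose_mul_geometric_of_norm_lt_one 1 (r := t) ht
  set F : ℕ × ℕ → ℝ := fun p => ((-1) ^ p.1 * (2 / ((p.1 : ℝ) + 1) ^ 2)) *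
    (((p.2 : ℝ) + 1) * (-y / ((p.1 : ℝ) + 1)) ^ p.2) with hF
  have hq : ∀ r : ℕ, |-y / ((r : ℝ) + 1)| ≤ y := by
    intro r
    rw [abs_div, abs_neg, abs_of_nonneg hy, abs_of_pos (by positivity : (0 : ℝ) < r + 1)]
    exact div_le_self hy (by have : (0 : ℝ) ≤ r := r.cast_nonneg; linarith)
  have hsF : Summable F := by
    have hs1 : Summable fun r : ℕ => ‖(-1 : ℝ) ^ r * (2 / ((r : ℝ) + 1) ^ 2)‖ := by
      simpa using (summable_alternating_sq le_rfl).norm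
    have hs2 : Summable fun n : ℕ => ((n : ℝ) + 1) * y ^ n :=
      (hgeom y (by rwa [abs_of_nonneg hy])).summable
    have hs := hs1.mul_of_nonneg hs2 (fun _ => norm_nonneg _) (fun n => by positivity)
    refine Summable.of_norm_bounded hs fun p => ?_
    simp only [hF]
    rw [norm_mul, norm_mul ((p.2 : ℝ) + 1), norm_pow,
      Real.norm_of_nonneg (by positivity : (0 : ℝ) ≤ (p.2 : ℝ) + 1)]
    have := hq p.1
    rw [← Real.norm_eq_abs] at this
    gcongr
  have hrow : ∀ r : ℕ, HasSum (fun n => F (r, n)) ((-1) ^ r * (2 / (y + r + 1) ^ 2)) := by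
    intro r
    convert! (hgeom _ ((hq r).trans_lt hy1)).mul_left ((-1) ^ r * (2 / ((r : ℝ) + 1) ^ 2)) using 1
    have : 1 - -y / ((r : ℝ) + 1) = (y + r + 1) / (r + 1) := by field_simp; ring
    rw [this]
    field_simp
  have hcol : ∀ n : ℕ, ∑' r, F (r, n) = 2 * (n + 1) * etaValue (n + 2) * (-y) ^ n := by
    intro n
    rw [etaValue, ← tsum_mul_left, ← tsum_mul_right]
    refine tsum_congr fun r => ?_
    simp only [hF]
    rw [div_pow, pow_add]
    field_simp
  have htot : starGen y = ∑' p, F p := by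
    rw [starGen_eq_tsum hy, hsF.tsum_prod]
    exact tsum_congr fun r => (hrow r).tsum_eq.symm
  have hswap : Summable fun p : ℕ × ℕ => F p.swap := hsF.prod_symm
  have h := hswap.hasSum.prod_fiberwise fun q => (hswap.prod_factor q).hasSum
  have e := (Equiv.prodComm ℕ ℕ).tsum_eq F
  simp only [Equiv.prodComm_apply] at e
  rw [e, ← htot] at h
  exact h.congr_fun fun n => (hcol n).symm

theorem sq_prod_inv_one_sub_le (k : ℕ) {t : ℝ} (ht : t ≤ 1 / 4) :
    (∏ j ∈ Finset.range (k + 1), (1 - t / ((j : ℝ) + 1))⁻¹) ^ 2 ≤ k + 2 := by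
  induction k with
  | zero =>
    have h : (1 - t)⁻¹ ≤ 4 / 3 := by
      rw [inv_le_comm₀ (by linarith) (by norm_num)]
      linarith
    have h0 : 0 ≤ (1 - t)⁻¹ := inv_nonneg.2 (by linarith)
    simp only [zero_add, Finset.prod_range_one]
    push_cast
    simp only [zero_add, div_one]
    nlinarith
  | succ k ih =>
    have hk : (0 : ℝ) ≤ k := k.cast_nonneg
    rw [Finset.prod_range_succ, mul_pow]
    push_cast
    have h2 : 1 - t / ((k : ℝ) + 1 + 1) = ((k : ℝ) + 2 - t) / (k + 2) := by
      field_simp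
      ring
    have hpos : (0 : ℝ) < k + 2 - t := by linarith
    rw [h2, inv_div, div_pow]
    calc _ ≤ ((k : ℝ) + 2) * (((k : ℝ) + 2) ^ 2 / (k + 2 - t) ^ 2) := by gcongr
      _ ≤ (k : ℝ) + 1 + 2 := by
        rw [mul_div_assoc', div_le_iff₀ (by positivity)]
        have h3 : ((k : ℝ) + 2 - 1 / 4) ^ 2 ≤ ((k : ℝ) + 2 - t) ^ 2 := by gcongr; linarith
        nlinarith

/-- The value `Z⋆₊(n) = 2 (n + 1) η(n + 2)`, with `η` the alternating zeta function. -/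
theorem ZStarPlus_eq (n : ℕ) : ZStarPlus n = 2 * (n + 1) * etaValue (n + 2) := by
  have h := eq_of_hasSum_pow (𝕜 := ℝ) (c := fun n : ℕ => ZStarPlus n * (-1) ^ n)
    (d := fun n : ℕ => 2 * (n + 1) * etaValue (n + 2) * (-1) ^ n) (δ := 1 / 4) (by norm_num)
    starGen ?_ ?_
  · have hn := congrFun h n
    exact mul_right_cancel₀ (pow_ne_zero n (by norm_num)) hn
  · intro x hx0 hx1
    have hs := hasSum_antidiagonal_heightOne (D := fun j => Finset.range (j + 1)) (ε := 1) (x := -x)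
      (fun k t ht => hasSum_chainSum_range_add_one ht k)
      (fun k t _ ht => sq_prod_inv_one_sub_le k ht) (by simp)
      (by rw [abs_neg, abs_of_pos hx0]; exact hx1.le)
    convert! hs using 2 with n
    · simp only [ZStarPlus, multipleZetaStar_heightOneIndex, one_pow, one_mul,
        RCLike.ofReal_real_eq_id, id]
      rw [neg_pow x, mul_assoc]
    · simp only [starGen, starProd, neg_div, sub_neg_eq_add, one_mul]
  · intro x hx0 hx1
    refine (hasSum_starGen hx0.le (by linarith)).congr_fun fun n => ?_
    rw [neg_pow x]
    simp only [RCLike.ofReal_real_eq_id, id]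
    ring

/-! ### Gauss' summation -/

/-- The `k`-th term `(x)ₖ² / (k! (1 + x + r)ₖ)` of the hypergeometric series
`₂F₁(x, x; 1 + x + r; 1)`. -/
noncomputable def gaussTerm (x : ℝ) (r k : ℕ) : ℝ :=
  ∏ j ∈ Finset.range k, (x + j) ^ 2 / (((j : ℝ) + 1) * (1 + x + r + j))

theorem gaussTerm_zero (x : ℝ) (r : ℕ) : gaussTerm x r 0 = 1 := by simp [gaussTerm]

theorem gaussTerm_succ (x : ℝ) (r k : ℕ) : gaussTerm x r (k + 1) =
    gaussTerm x r k * ((x + k) ^ 2 / (((k : ℝ) + 1) * (1 + x + r + k))) := by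
  rw [gaussTerm, Finset.prod_range_succ, ← gaussTerm]

theorem gaussTerm_pos {x : ℝ} (hx : 0 < x) (r k : ℕ) : 0 < gaussTerm x r k :=
  Finset.prod_pos fun j _ => by positivity

theorem gaussTerm_add_one {x : ℝ} (hx : 0 < x) (r k : ℕ) :
    gaussTerm x (r + 1) k = gaussTerm x r k * ((1 + x + r) / (1 + x + r + k)) := by
  induction k with
  | zero =>
    simp only [gaussTerm_zero, Nat.cast_zero, add_zero]
    field_simp
  | succ k ih =>
    rw [gaussTerm_succ, gaussTerm_succ, ih]
    push_cast
    field_simp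
    ring

theorem gaussTerm_zero_succ {x : ℝ} (hx : 0 < x) (k : ℕ) :
    gaussTerm x 0 (k + 1) = x ^ 2 * ((∏ j ∈ Finset.range k, (1 + x / ((j : ℝ) + 1))) /
      (((k : ℝ) + 1) * (k + 1 + x))) := by
  induction k with
  | zero => simp [gaussTerm, add_comm]; field_simp
  | succ k ih =>
    rw [gaussTerm_succ, ih, Finset.prod_range_succ]
    push_cast
    field_simp
    ring

theorem gaussTerm_le {x : ℝ} (hx : 0 < x) (r k : ℕ) :
    gaussTerm x r (k + 1) ≤ (1 + x) / (1 + x + r) * gaussTerm x 0 (k + 1) := by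
  induction r with
  | zero =>
    rw [Nat.cast_zero, add_zero, div_self (by positivity), one_mul]
  | succ r ih =>
    rw [gaussTerm_add_one hx]
    calc _ ≤ (1 + x) / (1 + x + r) * gaussTerm x 0 (k + 1) *
          ((1 + x + r) / (1 + x + r + 1)) := by
          have := gaussTerm_pos hx 0 (k + 1)
          push_cast
          gcongr
          have : (0 : ℝ) ≤ k := k.cast_nonneg
          linarith
      _ = _ := by
          push_cast
          field_simp
          ring

theorem prod_one_add_pos {x : ℝ} (hx : 0 ≤ x) (k : ℕ) :
    0 < ∏ j ∈ Finset.range k, (1 + x / ((j : ℝ) + 1)) :=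
  Finset.prod_pos fun j _ => by positivity

theorem sq_prod_one_add_le (k : ℕ) {t : ℝ} (ht0 : 0 ≤ t) (ht : t ≤ 1 / 4) :
    (∏ j ∈ Finset.range k, (1 + t / ((j : ℝ) + 1))) ^ 2 ≤ k + 1 := by
  induction k with
  | zero => simp
  | succ k ih =>
    have hk : (0 : ℝ) ≤ k := k.cast_nonneg
    rw [Finset.prod_range_succ, mul_pow]
    push_cast
    have h2 : 1 + t / ((k : ℝ) + 1) = ((k : ℝ) + 1 + t) / (k + 1) := by field_simp
    rw [h2, div_pow]
    calc _ ≤ ((k : ℝ) + 1) * (((k : ℝ) + 1 + t) ^ 2 / (k + 1) ^ 2) := by gcongr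
      _ ≤ (k : ℝ) + 1 + 1 := by
        rw [mul_div_assoc', div_le_iff₀ (by positivity)]
        have h3 : ((k : ℝ) + 1 + t) ^ 2 ≤ ((k : ℝ) + 1 + 1 / 4) ^ 2 := by gcongr
        nlinarith

theorem summable_gaussTerm {x : ℝ} (hx : 0 < x) (hx4 : x ≤ 1 / 4) (r : ℕ) :
    Summable (gaussTerm x r) := by
  have h0 : Summable fun k => gaussTerm x 0 (k + 1) := by
    simp only [gaussTerm_zero_succ hx]
    refine Summable.mul_left _ ?_
    have := summable_div_of_sq_le (t := -x) (fun k => (prod_one_add_pos hx.le k).le)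
      (fun k => (sq_prod_one_add_le k hx.le hx4).trans (by linarith)) (by linarith)
    simpa using this
  exact (summable_nat_add_iff 1).1
    (Summable.of_nonneg_of_le (fun k => (gaussTerm_pos hx r _).le) (fun k => gaussTerm_le hx r k)
      (h0.mul_left _))

theorem tendsto_mul_gaussTerm {x : ℝ} (hx : 0 < x) (hx4 : x ≤ 1 / 4) (r : ℕ) :
    Filter.Tendsto (fun k : ℕ => (k : ℝ) * gaussTerm x r k) Filter.atTop (nhds 0) := by
  rw [← Filter.tendsto_add_atTop_iff_nat 1]
  have hnn : ∀ k : ℕ, 0 ≤ ((k + 1 : ℕ) : ℝ) * gaussTerm x r (k + 1) := fun k =>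
    mul_nonneg (by positivity) (gaussTerm_pos hx r _).le
  have hsq : ∀ k : ℕ, (((k + 1 : ℕ) : ℝ) * gaussTerm x r (k + 1)) ^ 2 ≤ 1 / ((k : ℝ) + 1) := by
    intro k
    have hP := prod_one_add_pos hx.le k
    have h1 : ((k + 1 : ℕ) : ℝ) * gaussTerm x r (k + 1) ≤
        (∏ j ∈ Finset.range k, (1 + x / ((j : ℝ) + 1))) / (k + 1) := by
      calc _ ≤ ((k + 1 : ℕ) : ℝ) * (1 * gaussTerm x 0 (k + 1)) := by
            have h := gaussTerm_le hx r k
            have h0 := gaussTerm_pos hx 0 (k + 1)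
            have hle : (1 + x) / (1 + x + r) ≤ 1 := by
              rw [div_le_one (by positivity)]
              have : (0 : ℝ) ≤ r := r.cast_nonneg
              linarith
            have := h.trans (mul_le_mul_of_nonneg_right hle h0.le)
            gcongr
        _ = x ^ 2 * ((∏ j ∈ Finset.range k, (1 + x / ((j : ℝ) + 1))) / (k + 1 + x)) := by
            rw [gaussTerm_zero_succ hx]
            push_cast
            field_simp
        _ ≤ 1 * ((∏ j ∈ Finset.range k, (1 + x / ((j : ℝ) + 1))) / (k + 1)) := by
            have hx2 : x ^ 2 ≤ 1 := by nlinarith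
            have hle : (k : ℝ) + 1 ≤ k + 1 + x := by linarith
            gcongr
        _ = _ := one_mul _
    calc _ ≤ ((∏ j ∈ Finset.range k, (1 + x / ((j : ℝ) + 1))) / (k + 1)) ^ 2 :=
          pow_le_pow_left₀ (hnn k) h1 2
      _ ≤ ((k : ℝ) + 1) / (k + 1) ^ 2 := by
          rw [div_pow]
          have := sq_prod_one_add_le k hx.le hx4
          gcongr
      _ = _ := by field_simp
  have hlim := squeeze_zero (fun k => sq_nonneg _) hsq tendsto_one_div_add_atTop_nhds_zero_nat
  have h := (Real.continuous_sqrt.tendsto' 0 0 Real.sqrt_zero).comp hlim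
  exact h.congr fun k => Real.sqrt_sq (hnn k)

/-- Gauss' contiguity relation for `₂F₁(x, x; 1 + x + r; 1)`, shifting the lower parameter. -/
theorem tsum_gaussTerm_step {x : ℝ} (hx : 0 < x) (hx4 : x ≤ 1 / 4) (r : ℕ) :
    (∑' k, gaussTerm x r k) * (1 - x ^ 2 / ((r : ℝ) + 1) ^ 2) = ∑' k, gaussTerm x (r + 1) k := by
  -- The antidifference of the contiguity relation is a multiple of `k * gaussTerm x r k`.
  have hterm : ∀ k : ℕ, (1 + x + r) * (1 + r - x) * gaussTerm x r k -
      (1 + r) ^ 2 * gaussTerm x (r + 1) k =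
      (1 + x + r) * (k * gaussTerm x r k - ((k + 1 : ℕ) : ℝ) * gaussTerm x r (k + 1)) := by
    intro k
    rw [gaussTerm_add_one hx, gaussTerm_succ]
    push_cast
    field_simp
    ring
  have hsum := (((summable_gaussTerm hx hx4 r).hasSum.mul_left ((1 + x + r) * (1 + r - x))).sub
    ((summable_gaussTerm hx hx4 (r + 1)).hasSum.mul_left ((1 + r : ℝ) ^ 2))).tendsto_sum_nat
  simp only [hterm, ← Finset.mul_sum] at hsum
  simp only [Finset.sum_range_sub' (fun k : ℕ => (k : ℝ) * gaussTerm x r k)] at hsum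
  have hlim := ((tendsto_mul_gaussTerm hx hx4 r).const_sub
    (((0 : ℕ) : ℝ) * gaussTerm x r 0)).const_mul (1 + x + r)
  have heq := tendsto_nhds_unique hsum hlim
  simp only [Nat.cast_zero, zero_mul, sub_zero, mul_zero] at heq
  field_simp
  linear_combination heq

theorem tsum_gaussTerm_mul_prod {x : ℝ} (hx : 0 < x) (hx4 : x ≤ 1 / 4) (N : ℕ) :
    (∑' k, gaussTerm x 0 k) * ∏ j ∈ Finset.range N, (1 - x ^ 2 / ((j : ℝ) + 1) ^ 2) =
      ∑' k, gaussTerm x N k := by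
  induction N with
  | zero => simp
  | succ N ih => rw [Finset.prod_range_succ, ← mul_assoc, ih, tsum_gaussTerm_step hx hx4]

theorem tendsto_tsum_gaussTerm {x : ℝ} (hx : 0 < x) (hx4 : x ≤ 1 / 4) :
    Filter.Tendsto (fun N : ℕ => ∑' k, gaussTerm x N k) Filter.atTop (nhds 1) := by
  have hs : ∀ N, Summable fun k => gaussTerm x N (k + 1) := fun N =>
    (summable_nat_add_iff 1).2 (summable_gaussTerm hx hx4 N)
  have heq : ∀ N : ℕ, ∑' k, gaussTerm x N k = 1 + ∑' k, gaussTerm x N (k + 1) := fun N => by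
    rw [(summable_gaussTerm hx hx4 N).tsum_eq_zero_add, gaussTerm_zero]
  simp only [heq]
  set S := ∑' k, gaussTerm x 0 (k + 1) with hS
  have hS0 : 0 ≤ S := tsum_nonneg fun k => (gaussTerm_pos hx 0 _).le
  have h0 : Filter.Tendsto (fun N : ℕ => (1 + x) * S * (1 / ((N : ℝ) + 1))) Filter.atTop
      (nhds 0) := by
    simpa using tendsto_one_div_add_atTop_nhds_zero_nat.const_mul ((1 + x) * S)
  have h1 : Filter.Tendsto (fun N : ℕ => ∑' k, gaussTerm x N (k + 1)) Filter.atTop (nhds 0) := by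
    refine squeeze_zero (fun N => tsum_nonneg fun k => (gaussTerm_pos hx N _).le) (fun N => ?_) h0
    calc ∑' k, gaussTerm x N (k + 1) ≤ ∑' k, (1 + x) / (1 + x + N) * gaussTerm x 0 (k + 1) :=
          (hs N).tsum_le_tsum (fun k => gaussTerm_le hx N k) ((hs 0).mul_left _)
      _ = (1 + x) / (1 + x + N) * S := tsum_mul_left
      _ ≤ (1 + x) / (N + 1) * S := by
          have hle : (N : ℝ) + 1 ≤ 1 + x + N := by linarith
          gcongr
      _ = _ := by ring
  simpa using h1.const_add 1

/-- Gauss' summation `₂F₁(x, x; 1 + x; 1) = Γ(1 + x) Γ(1 - x) = π x / sin (π x)`. -/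
theorem tsum_gaussTerm_mul_sin {x : ℝ} (hx : 0 < x) (hx4 : x ≤ 1 / 4) :
    (∑' k, gaussTerm x 0 k) * Real.sin (Real.pi * x) = Real.pi * x := by
  have h1 := (Real.tendsto_euler_sin_prod x).const_mul (∑' k, gaussTerm x 0 k)
  have h2 := (tendsto_tsum_gaussTerm hx hx4).const_mul (Real.pi * x)
  rw [mul_one] at h2
  refine tendsto_nhds_unique h1 (h2.congr fun N => ?_)
  rw [← tsum_gaussTerm_mul_prod hx hx4]
  ring

/-- The terms of positive index in Gauss' series are, up to the factor `x²`, the outer series of the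
generating function of `Z₋`. -/
theorem hasSum_ZMinus {x : ℝ} (hx : 0 < x) (hx4 : x ≤ 1 / 4) :
    HasSum (fun n => ZMinus n * x ^ (n + 2)) (∑' k, gaussTerm x 0 k - 1) := by
  have hs := hasSum_antidiagonal_heightOne (D := Finset.range) (ε := -1) (x := x)
    (fun k t _ => hasSum_chainSum_range t k)
    (fun k t ht0 ht => (sq_prod_one_add_le k ht0 ht).trans (by linarith)) (by simp)
    (by rwa [abs_of_pos hx])
  rw [(summable_gaussTerm hx hx4 0).tsum_eq_zero_add, gaussTerm_zero, add_sub_cancel_left]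
  simp only [gaussTerm_zero_succ hx, tsum_mul_left]
  convert! hs.mul_left (x ^ 2) using 2 with n
  · simp only [ZMinus, multipleZeta_heightOneIndex]
    ring
  · simp only [neg_mul, one_mul, sub_neg_eq_add]

/-! ### Bernoulli series -/

section

open PowerSeries

/-- With `B = X / (exp X - 1)`, the series `2 B(X / 2) - B` is `(X / 2) / sinh (X / 2)`. -/
theorem two_mul_rescale_bernoulli_sub_mul :
    (2 * rescale (1 / 2 : ℂ) (bernoulliPowerSeries ℂ) - bernoulliPowerSeries ℂ) * (exp ℂ - 1) =
      X * rescale (1 / 2 : ℂ) (exp ℂ) := by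
  have h1 := bernoulliPowerSeries_mul_exp_sub_one ℂ
  have h2 := congrArg (rescale (1 / 2 : ℂ)) h1
  rw [map_mul, map_sub, map_one, rescale_X] at h2
  have h3 := exp_mul_exp_eq_exp_add (1 / 2 : ℂ) (1 / 2)
  rw [add_halves, rescale_one, RingHom.id_apply] at h3
  have h4 : (2 : PowerSeries ℂ) * C (1 / 2 : ℂ) = 1 := by
    rw [← map_ofNat (C (R := ℂ)) 2, ← map_mul]
    norm_num
  linear_combination (2 * (rescale (1 / 2 : ℂ) (exp ℂ) + 1)) * h2 - h1 +
    X * (rescale (1 / 2 : ℂ) (exp ℂ) + 1) * h4 -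
    2 * rescale (1 / 2 : ℂ) (bernoulliPowerSeries ℂ) * h3

theorem exp_sub_one_ne_zero : exp ℂ - 1 ≠ 0 := by
  intro h
  have := bernoulliPowerSeries_mul_exp_sub_one ℂ
  rw [h, mul_zero] at this
  exact X_ne_zero this.symm

/-- The formal counterpart of `(x / sin x)² = x cot x - x (x cot x)'`: both sides are
`X² exp X / (exp X - 1)²`. -/
theorem sq_two_mul_rescale_bernoulli_sub :
    (2 * rescale (1 / 2 : ℂ) (bernoulliPowerSeries ℂ) - bernoulliPowerSeries ℂ) ^ 2 =
      bernoulliPowerSeries ℂ - X * derivative ℂ (bernoulliPowerSeries ℂ) := by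
  have h1 := bernoulliPowerSeries_mul_exp_sub_one ℂ
  have h2 := congrArg (derivative ℂ) h1
  rw [Derivation.leibniz, map_sub, derivative_exp, derivative_one, derivative_X, sub_zero,
    smul_eq_mul, smul_eq_mul] at h2
  have h3 := exp_mul_exp_eq_exp_add (1 / 2 : ℂ) (1 / 2)
  rw [add_halves, rescale_one, RingHom.id_apply] at h3
  have h4 := two_mul_rescale_bernoulli_sub_mul
  refine mul_right_cancel₀ (pow_ne_zero 2 exp_sub_one_ne_zero) ?_
  rw [← mul_pow, h4, mul_pow, sq (rescale (1 / 2 : ℂ) (exp ℂ)), h3]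
  linear_combination (X * (exp ℂ - 1)) * h2 - (exp ℂ - 1 + X * exp ℂ) * h1

/-! ### The expansion of `π x / sin (π x)` -/

theorem hasSum_coeff_mul {A B : PowerSeries ℂ} {z s t : ℂ}
    (hA : HasSum (fun n => coeff n A * z ^ n) s) (hB : HasSum (fun n => coeff n B * z ^ n) t) :
    HasSum (fun n => coeff n (A * B) * z ^ n) (s * t) := by
  have h := (summable_norm_sum_mul_antidiagonal_of_summable_norm hA.summable.norm
    hB.summable.norm).of_norm.hasSum
  rw [← tsum_mul_tsum_eq_tsum_sum_antidiagonal_of_summable_norm hA.summable.norm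
    hB.summable.norm, hA.tsum_eq, hB.tsum_eq] at h
  refine h.congr_fun fun n => ?_
  rw [coeff_mul, Finset.sum_mul]
  refine Finset.sum_congr rfl fun ij hij => ?_
  rw [← Finset.HasAntidiagonal.mem_antidiagonal.1 hij, pow_add]
  ring

theorem hasSum_coeff_rescale_exp (c z : ℂ) :
    HasSum (fun n => coeff n (rescale c (exp ℂ)) * z ^ n) (Complex.exp (c * z)) := by
  have h := NormedSpace.expSeries_div_hasSum_exp (c * z)
  rw [← Complex.exp_eq_exp_ℂ] at h
  refine h.congr_fun fun n => ?_
  rw [coeff_rescale, coeff_exp, mul_pow]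
  simp
  ring

theorem hasSum_coeff_C_mul_X (c z : ℂ) :
    HasSum (fun n => coeff n (C c * X) * z ^ n) (c * z) := by
  convert! hasSum_single (f := fun n => coeff n (C c * X) * z ^ n) 1 fun n hn => ?_ using 1
  · simp
  · simp [coeff_X, hn]

/-- The series `1 + ∑ Z₋(n) X^(n+2)`, the expansion of `π x / sin (π x)`. -/
noncomputable def minusSeries : PowerSeries ℂ :=
  1 + PowerSeries.X ^ 2 * PowerSeries.mk fun n => (ZMinus n : ℂ)

theorem coeff_minusSeries (n : ℕ) : coeff (n + 2) minusSeries = ZMinus n := by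
  simp [minusSeries, coeff_one]

theorem hasSum_minusSeries {x : ℝ} (hx : 0 < x) (hx4 : x ≤ 1 / 4) :
    HasSum (fun n => coeff n minusSeries * (x : ℂ) ^ n) ((∑' k, gaussTerm x 0 k : ℝ) : ℂ) := by
  have h0 : coeff 0 minusSeries = 1 := by simp [minusSeries]
  have h1 : coeff 1 minusSeries = 0 := by
    simp [minusSeries, coeff_one, coeff_X_pow_mul']
  rw [← hasSum_nat_add_iff' 2]
  convert! Complex.hasSum_ofReal.2 (hasSum_ZMinus hx hx4) using 1
  · funext n
    rw [coeff_minusSeries]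
    push_cast
    rfl
  · simp [Finset.sum_range_succ, h0, h1]

/-- The identity `(π x / sin (π x)) (exp (2 π i x) - 1) = 2 π i x exp (π i x)`, transferred from
functions on `(0, 1/4)` to formal power series. -/
theorem minusSeries_mul :
    minusSeries * (rescale (2 * Real.pi * Complex.I) (exp ℂ) - 1) =
      C (2 * Real.pi * Complex.I) * X * rescale (Real.pi * Complex.I) (exp ℂ) := by
  have hcoe := eq_of_hasSum_pow (𝕜 := ℂ) (δ := 1 / 4) (by norm_num)
    (c := fun n => coeff n (minusSeries * (rescale (2 * Real.pi * Complex.I) (exp ℂ) - 1)))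
    (d := fun n => coeff n
      (C (2 * Real.pi * Complex.I) * X * rescale (Real.pi * Complex.I) (exp ℂ)))
    (fun x => 2 * Real.pi * Complex.I * x * Complex.exp (Real.pi * Complex.I * x)) ?_ ?_
  · ext n
    exact congrFun hcoe n
  · intro x hx0 hx1
    have hone : HasSum (fun n => coeff n (1 : PowerSeries ℂ) * (x : ℂ) ^ n) 1 := by
      convert! hasSum_single (f := fun n => coeff n (1 : PowerSeries ℂ) * (x : ℂ) ^ n) 0
        fun n hn => ?_ using 1
      · simp
      · simp [coeff_one, hn]
    have hexp := (hasSum_coeff_rescale_exp (2 * Real.pi * Complex.I) x).sub hone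
    simp only [← sub_mul, ← map_sub] at hexp
    have h := hasSum_coeff_mul (hasSum_minusSeries hx0 hx1.le) hexp
    convert! h using 1
    have hsin := congrArg ((↑) : ℝ → ℂ) (tsum_gaussTerm_mul_sin hx0 hx1.le)
    push_cast at hsin
    rw [Complex.sin] at hsin
    have he : Complex.exp (2 * Real.pi * Complex.I * x) =
        Complex.exp (Real.pi * x * Complex.I) * Complex.exp (Real.pi * x * Complex.I) := by
      rw [← Complex.exp_add]
      ring_nf
    have hinv : Complex.exp (-(Real.pi * x) * Complex.I) *
        Complex.exp (Real.pi * x * Complex.I) = 1 := by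
      rw [← Complex.exp_add, neg_mul, neg_add_cancel, Complex.exp_zero]
    rw [he, show (Real.pi : ℂ) * Complex.I * x = Real.pi * x * Complex.I by ring]
    push_cast
    linear_combination (-2 * Complex.I * Complex.exp (Real.pi * x * Complex.I)) * hsin +
      (∑' k, (gaussTerm x 0 k : ℂ)) * ((Complex.I ^ 2) * hinv +
       (1 - Complex.exp (Real.pi * x * Complex.I) ^ 2) * Complex.I_sq)
  · intro x _ _
    exact hasSum_coeff_mul (hasSum_coeff_C_mul_X _ _) (hasSum_coeff_rescale_exp _ _)

theorem minusSeries_eq :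
    minusSeries = rescale (2 * Real.pi * Complex.I)
      (2 * rescale (1 / 2 : ℂ) (bernoulliPowerSeries ℂ) - bernoulliPowerSeries ℂ) := by
  have h := congrArg (rescale (2 * Real.pi * Complex.I)) two_mul_rescale_bernoulli_sub_mul
  rw [map_mul, map_sub _ (exp ℂ), map_one, map_mul _ X, rescale_X, rescale_rescale,
    show (1 / 2 : ℂ) * (2 * Real.pi * Complex.I) = Real.pi * Complex.I by ring,
    ← minusSeries_mul] at h
  refine (mul_right_cancel₀ (fun h0 => ?_) h).symm
  have h1 := congrArg (coeff 1) h0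
  simp [coeff_rescale, coeff_exp, coeff_one, Real.pi_ne_zero] at h1

/-! ### Values of `Z₋` and their convolution -/

/-- Euler's formula for `ζ(2k)`. -/
theorem two_pi_I_pow_mul_bernoulli {k : ℕ} (hk : k ≠ 0) :
    (2 * Real.pi * Complex.I) ^ (2 * k) * (bernoulli (2 * k) / (Nat.factorial (2 * k)) : ℂ) =
      -2 * riemannZeta (2 * k) := by
  rw [riemannZeta_two_mul_nat hk]
  obtain ⟨j, rfl⟩ := Nat.exists_eq_succ_of_ne_zero hk
  rw [mul_pow, mul_pow, pow_mul Complex.I, Complex.I_sq,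
    show 2 * j.succ - 1 = 2 * j + 1 by lia, show 2 * j.succ = 2 * j + 1 + 1 by lia]
  ring

theorem ZMinus_eq (n : ℕ) : (ZMinus n : ℂ) = (2 * Real.pi * Complex.I) ^ (n + 2) *
    ((2 * (1 / 2) ^ (n + 2) - 1) * (bernoulli (n + 2) / (Nat.factorial (n + 2)))) := by
  rw [← coeff_minusSeries, minusSeries_eq, coeff_rescale, map_sub,
    ← map_ofNat (C (R := ℂ)) 2, coeff_C_mul, coeff_rescale, bernoulliPowerSeries, coeff_mk]
  simp
  ring

theorem ZMinus_odd (m : ℕ) : ZMinus (2 * m + 1) = 0 := by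
  have h := ZMinus_eq (2 * m + 1)
  rw [bernoulli_eq_zero_of_odd ⟨m + 1, by ring⟩ (by lia)] at h
  simpa using h

theorem ZMinus_even (m : ℕ) : (ZMinus (2 * m) : ℂ) =
    2 * (1 - (1 / 2) ^ (2 * m + 1)) * riemannZeta (2 * m + 2) := by
  have h := two_pi_I_pow_mul_bernoulli (Nat.succ_ne_zero m)
  rw [Nat.succ_eq_add_one, mul_add, mul_one] at h
  push_cast at h
  rw [ZMinus_eq, mul_left_comm]
  rw [mul_add, mul_one] at h
  rw [h]
  ring

/-- The convolution of `Z₋` with itself, read off from the square of `minusSeries`. -/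
theorem sum_antidiagonal_ZMinus (p : ℕ) :
    (∑ ij ∈ Finset.HasAntidiagonal.antidiagonal (2 * p), (ZMinus ij.1 : ℂ) * ZMinus ij.2) +
      2 * ZMinus (2 * p + 2) = 2 * (2 * p + 3) * riemannZeta (2 * p + 4) := by
  have hsq : minusSeries ^ 2 = 1 + X ^ 2 * ((mk fun n => (ZMinus n : ℂ)) +
      (mk fun n => (ZMinus n : ℂ)) +
      X ^ 2 * ((mk fun n => (ZMinus n : ℂ)) * mk fun n => (ZMinus n : ℂ))) := by
    rw [minusSeries]
    ring
  have hB : minusSeries ^ 2 = rescale (2 * Real.pi * Complex.I)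
      (bernoulliPowerSeries ℂ - X * derivative ℂ (bernoulliPowerSeries ℂ)) := by
    rw [minusSeries_eq, ← map_pow, sq_two_mul_rescale_bernoulli_sub]
  have hc := congrArg (coeff (2 * p + 2 + 2)) (hsq.symm.trans hB)
  rw [map_add, coeff_X_pow_mul, map_add, map_add, coeff_X_pow_mul, coeff_mul, coeff_rescale,
    map_sub, coeff_succ_X_mul, coeff_derivative, bernoulliPowerSeries] at hc
  have h := two_pi_I_pow_mul_bernoulli (Nat.succ_ne_zero (p + 1))
  rw [Nat.succ_eq_add_one, show 2 * (p + 1 + 1) = 2 * p + 2 + 2 by ring] at h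
  simp only [coeff_mk, coeff_one] at hc
  simp at hc
  push_cast at h
  rw [show (2 : ℂ) * (p + 1 + 1) = 2 * p + 4 by ring] at h
  linear_combination hc - (2 * p + 3) * h

end

/-! ### Alternating zeta values and the symmetrized sum -/

theorem etaValue_eq {s : ℕ} (hs : 1 < s) :
    (etaValue s : ℂ) = (1 - 2 * (1 / 2) ^ s) * riemannZeta s := by
  have hsum : Summable fun n : ℕ => 1 / ((n : ℝ) + 1) ^ s := by
    simpa using (summable_nat_add_iff 1).2 (Real.summable_one_div_nat_pow.2 hs)
  have hzeta : riemannZeta s = ((∑' n : ℕ, 1 / ((n : ℝ) + 1) ^ s : ℝ) : ℂ) := by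
    have h := (Real.summable_one_div_nat_pow.2 hs).tsum_eq_zero_add
    rw [Nat.cast_zero, zero_pow (by lia), div_zero, zero_add] at h
    push_cast at h
    rw [zeta_nat_eq_tsum_of_gt_one hs, ← h]
    push_cast
    rfl
  have hinj2 : Function.Injective fun k : ℕ => 2 * k := fun _ _ h => by simpa using h
  have hinj1 : Function.Injective fun k : ℕ => 2 * k + 1 := fun _ _ h => by simpa using h
  have halt : Summable fun r : ℕ => (-1 : ℝ) ^ r / ((r : ℝ) + 1) ^ s :=
    Summable.of_norm_bounded hsum fun r => by
      rw [norm_div, norm_pow, norm_neg, norm_one, one_pow, Real.norm_of_nonneg (by positivity)]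
  have h1 : (∑' k : ℕ, 1 / (((2 * k : ℕ) : ℝ) + 1) ^ s) +
      ∑' k : ℕ, 1 / (((2 * k + 1 : ℕ) : ℝ) + 1) ^ s = ∑' n : ℕ, 1 / ((n : ℝ) + 1) ^ s :=
    tsum_even_add_odd (f := fun n : ℕ => 1 / ((n : ℝ) + 1) ^ s)
      (hsum.comp_injective hinj2) (hsum.comp_injective hinj1)
  have h2 : (∑' k : ℕ, 1 / (((2 * k : ℕ) : ℝ) + 1) ^ s) -
      ∑' k : ℕ, 1 / (((2 * k + 1 : ℕ) : ℝ) + 1) ^ s = etaValue s := by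
    rw [etaValue, ← tsum_even_add_odd (f := fun r : ℕ => (-1 : ℝ) ^ r / ((r : ℝ) + 1) ^ s)
        (halt.comp_injective hinj2) (halt.comp_injective hinj1),
      sub_eq_add_neg, ← tsum_neg]
    congr 1
    · exact tsum_congr fun k => by rw [(even_two_mul k).neg_one_pow]
    · exact tsum_congr fun k => by rw [(odd_two_mul_add_one k).neg_one_pow, neg_div]
  have hodd : ∑' k : ℕ, 1 / (((2 * k + 1 : ℕ) : ℝ) + 1) ^ s =
      (1 / 2) ^ s * ∑' n : ℕ, 1 / ((n : ℝ) + 1) ^ s := by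
    rw [← tsum_mul_left]
    refine tsum_congr fun k => ?_
    rw [one_div_pow, one_div_mul_one_div, ← mul_pow]
    push_cast
    ring_nf
  have hreal : etaValue s = (1 - 2 * (1 / 2) ^ s) * ∑' n : ℕ, 1 / ((n : ℝ) + 1) ^ s := by
    rw [hodd] at h1 h2
    linear_combination h1 - h2
  rw [hreal, hzeta]
  push_cast
  ring

theorem ZStarPlus_even (m : ℕ) : ZStarPlus (2 * m) = (2 * m + 1) * ZMinus (2 * m) := by
  have h : (ZStarPlus (2 * m) : ℂ) = (2 * m + 1) * ZMinus (2 * m) := by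
    have := etaValue_eq (s := 2 * m + 2) (by lia)
    rw [ZMinus_even, ZStarPlus_eq]
    push_cast at this ⊢
    rw [this]
    ring
  exact_mod_cast h

theorem sum_range_two_mul_add_one {M : Type*} [AddCommMonoid M] {f : ℕ → M}
    (hf : ∀ m, f (2 * m + 1) = 0) (p : ℕ) :
    ∑ i ∈ Finset.range (2 * p + 1), f i = ∑ m ∈ Finset.range (p + 1), f (2 * m) := by
  induction p with
  | zero => simp
  | succ p ih =>
    rw [Finset.sum_range_succ _ (p + 1), ← ih, show 2 * (p + 1) + 1 = 2 * p + 1 + 1 + 1 by ring,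
      Finset.sum_range_succ, Finset.sum_range_succ, hf, add_zero]
    rfl

theorem theorem1p2 (p : ℕ) :
    ((∑ m ∈ Finset.range (p + 1), ZMinus (2 * m) * ZStarPlus (2 * p - 2 * m) : ℝ) : ℂ) =
      (2 * (p : ℂ) + 2) * (2 * (p : ℂ) + 1 + ((2 : ℂ) ^ (2 * p + 2))⁻¹) *
        riemannZeta (2 * (p : ℂ) + 4) := by
  have hanti : (∑ ij ∈ Finset.HasAntidiagonal.antidiagonal (2 * p),
      (ZMinus ij.1 : ℂ) * ZMinus ij.2) =
      ((∑ m ∈ Finset.range (p + 1), ZMinus (2 * m) * ZMinus (2 * (p - m)) : ℝ) : ℂ) := by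
    rw [Finset.Nat.sum_antidiagonal_eq_sum_range_succ
      (fun i j => (ZMinus i : ℂ) * ZMinus j) (2 * p),
      sum_range_two_mul_add_one (fun m => by rw [ZMinus_odd]; simp)]
    push_cast
    exact Finset.sum_congr rfl fun m _ => by rw [Nat.mul_sub]
  -- Averaging with the reflected sum replaces the weight `2 (p - m) + 1` by its mean `p + 1`.
  have hsymm : ∑ m ∈ Finset.range (p + 1), ZMinus (2 * m) * ZStarPlus (2 * p - 2 * m) =
      (p + 1) * ∑ m ∈ Finset.range (p + 1), ZMinus (2 * m) * ZMinus (2 * (p - m)) := by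
    have h1 : ∀ m ∈ Finset.range (p + 1), ZMinus (2 * m) * ZStarPlus (2 * p - 2 * m) =
        (2 * ((p : ℝ) - m) + 1) * (ZMinus (2 * m) * ZMinus (2 * (p - m))) := by
      intro m hm
      rw [← Nat.mul_sub, ZStarPlus_even, Nat.cast_sub (Finset.mem_range_succ_iff.1 hm)]
      ring
    rw [Finset.sum_congr rfl h1]
    have h2 := Finset.sum_range_reflect
      (fun m => (2 * ((p : ℝ) - m) + 1) * (ZMinus (2 * m) * ZMinus (2 * (p - m)))) (p + 1)
    have h3 : ∀ m ∈ Finset.range (p + 1), (fun m : ℕ => (2 * ((p : ℝ) - m) + 1) *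
        (ZMinus (2 * m) * ZMinus (2 * (p - m)))) (p + 1 - 1 - m) =
        (2 * (m : ℝ) + 1) * (ZMinus (2 * m) * ZMinus (2 * (p - m))) := by
      intro m hm
      have hle := Finset.mem_range_succ_iff.1 hm
      simp only [Nat.add_sub_cancel, Nat.sub_sub_self hle, Nat.cast_sub hle]
      ring
    rw [Finset.sum_congr rfl h3] at h2
    have h4 : ∑ m ∈ Finset.range (p + 1), (2 * ((p : ℝ) - m) + 1) *
        (ZMinus (2 * m) * ZMinus (2 * (p - m))) + ∑ m ∈ Finset.range (p + 1), (2 * (m : ℝ) + 1) *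
        (ZMinus (2 * m) * ZMinus (2 * (p - m))) =
        2 * ((p + 1) * ∑ m ∈ Finset.range (p + 1), ZMinus (2 * m) * ZMinus (2 * (p - m))) := by
      rw [← Finset.sum_add_distrib, Finset.mul_sum, Finset.mul_sum]
      exact Finset.sum_congr rfl fun m _ => by ring
    linarith
  have hconv := sum_antidiagonal_ZMinus p
  have heven := ZMinus_even (p + 1)
  rw [show 2 * (p + 1) = 2 * p + 2 by ring] at heven
  push_cast at heven
  rw [show (2 : ℂ) * (p + 1) + 2 = 2 * p + 4 by ring] at heven
  rw [hanti, heven] at hconv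
  rw [hsymm]
  push_cast at hconv ⊢
  rw [← inv_pow, ← one_div]
  linear_combination ((p : ℂ) + 1) * hconv
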